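/- For $n\ge 1$ and $\sigma\in\mathfrak S_n$ let $\sigma^*$ be the permutation of $\{0,1,\dots,n\}$ with $\sigma^*(0)=n$ and $\sigma^*(i)=\sigma(i)-1$ for $1\le i\le n$ (the star companion of $\sigma$). Put $\mathsf{exc}\,\sigma=\#\{i\in[n]:\sigma(i)>i\}$, let $\mathsf{cyc}^*\sigma$ be the number of cycles of $\sigma^*$ (fixed points included), and let $$\mathsf{fix}^*\sigma=\#\{i\in[n-1]:\sigma^*(i)=i\},\qquad \mathsf{cpk}^*\sigma=\#\{i\in[n-1]:(\sigma^*)^{-1}(i)<i>\sigma^*(i)\}.$$ Define $$A_n(q,t)=\sum_{\sigma\in\mathfrak S_n}q^{\mathsf{cyc}^*\sigma-\mathsf{fix}^*\sigma}\,t^{\mathsf{exc}\,\sigma},\qquad P_n(q,x,t)=\sum_{\sigma\in\mathfrak S_n}q^{\mathsf{cyc}^*\sigma-\mathsf{fix}^*\sigma}\,x^{\mathsf{cpk}^*\sigma}\,t^{\mathsf{exc}\,\sigma}.$$ Let $K$ be any field and $n\ge1$. (1) For all $q,x,t\in K$ with $1+x$, $x+t$ and $1+xt$ nonzero, $$A_n(q,t)=\left(\frac{1+xt}{1+x}\right)^{n-1}P_n\!\left(q,\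 \frac{(1+x)^2t}{(x+t)(1+xt)},\ \frac{x+t}{1+xt}\right).$$ (2) Equivalently (inverting the substitution): if $2\neq0$ in $K$, then for all $q,x,t\in K$ with $x\ne0$, $x\neq1$, $t\neq0$, and for any square root $\sqrt{(1+t)^2-4xt}\in K$, put $$u=\frac{1+t^2-2xt-(1-t)\sqrt{(1+t)^2-4xt}}{2(1-x)t},\qquad v=\frac{(1+t)^2-2xt-(1+t)\sqrt{(1+t)^2-4xt}}{2xt}.$$ If $1+uv\ne0$, then $$P_n(q,x,t)=\left(\frac{1+u}{1+uv}\right)^{n-1}A_n(q,v).$$ -/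

import Mathlib

/-!
Permutations of `[n] = {1, …, n}` are modelled by `Equiv.Perm (Fin n)`, the letter `i + 1 ∈ [n]`
being `i : Fin n`. Permutations of `{0, …, n}` are modelled by `Equiv.Perm (Fin (n + 1))`, the
letter `i` being `i : Fin (n + 1)`.
-/

namespace StarStat

open Finset

/-- The number of excedances of `σ`: indices `i` with `σ(i) > i`. -/
def exc {n : ℕ} (σ : Equiv.Perm (Fin n)) : ℕ :=
  #{i : Fin n | i < σ i}

/-- The star companion `σ*` of `σ ∈ 𝔖ₙ`: the permutation of `{0, …, n}` with `σ*(0) = n` and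
`σ*(i) = σ(i) - 1` for `1 ≤ i ≤ n`. (With the letter `i + 1` of `[n]` written as `i : Fin n`, this
reads `σ* (i + 1) = σ i`.) -/
def star {n : ℕ} (σ : Equiv.Perm (Fin n)) : Equiv.Perm (Fin (n + 1)) where
  toFun := Fin.cons (Fin.last n) fun i => (σ i).castSucc
  invFun := Fin.snoc (fun j => (σ.symm j).succ) 0
  left_inv := by
    intro i
    refine Fin.cases ?_ (fun j => ?_) i <;> simp
  right_inv := by
    intro i
    refine Fin.lastCases ?_ (fun j => ?_) i <;> simp

/-- The number of cycles of a permutation of a finite set, fixed points counted as cycles of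
length one: `τ.partition.parts` is the multiset of all cycle lengths of `τ`. -/
def cyc {α : Type*} [Fintype α] [DecidableEq α] (τ : Equiv.Perm α) : ℕ :=
  Multiset.card τ.partition.parts

/-- `cyc* σ = cyc σ*`. -/
def cycStar {n : ℕ} (σ : Equiv.Perm (Fin n)) : ℕ :=
  cyc (star σ)

/-- `Fix* σ = {i ∈ [n-1] : σ*(i) = i}`. -/
def FixStar {n : ℕ} (σ : Equiv.Perm (Fin n)) : Finset (Fin (n + 1)) :=
  {i | (1 ≤ (i : ℕ) ∧ (i : ℕ) ≤ n - 1) ∧ star σ i = i}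

/-- `fix* σ = |Fix* σ|`. -/
def fixStar {n : ℕ} (σ : Equiv.Perm (Fin n)) : ℕ :=
  #(FixStar σ)

/-- `Cpk* σ = {i ∈ [n-1] : (σ*)⁻¹(i) < i > σ*(i)}`. -/
def CpkStar {n : ℕ} (σ : Equiv.Perm (Fin n)) : Finset (Fin (n + 1)) :=
  {i | (1 ≤ (i : ℕ) ∧ (i : ℕ) ≤ n - 1) ∧ (star σ)⁻¹ i < i ∧ star σ i < i}

/-- `cpk* σ = |Cpk* σ|`. -/
def cpkStar {n : ℕ} (σ : Equiv.Perm (Fin n)) : ℕ :=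
  #(CpkStar σ)

/-- Each element of `Fix* σ` is a cycle of `σ*`, so the natural-number subtraction
`cyc* σ - fix* σ` never truncates. -/
theorem fixStar_le_cycStar {n : ℕ} (σ : Equiv.Perm (Fin n)) : fixStar σ ≤ cycStar σ := by
  have h1 : #(FixStar σ) ≤ #((star σ).support)ᶜ := by
    refine card_le_card fun i hi => ?_
    simp only [FixStar, mem_filter, mem_univ, true_and] at hi
    simp [hi.2]
  rw [card_compl] at h1
  simp only [fixStar, cycStar, cyc, Equiv.Perm.parts_partition, Multiset.card_add,
    Multiset.card_replicate]
  omega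

/-- The cycle refinement of the Eulerian polynomial,
`A_n^{(cyc* - fix*, exc)}(q, t) = ∑_{σ ∈ 𝔖ₙ} q^{cyc* σ - fix* σ} t^{exc σ}`. -/
def cycEulerian {K : Type*} [CommSemiring K] (n : ℕ) (q t : K) : K :=
  ∑ σ : Equiv.Perm (Fin n), q ^ (cycStar σ - fixStar σ) * t ^ exc σ

/-- The generating polynomial `P^{(cyc* - fix*, cpk*, exc)}(𝔖ₙ; q, x, t)
= ∑_{σ ∈ 𝔖ₙ} q^{cyc* σ - fix* σ} x^{cpk* σ} t^{exc σ}`. -/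
def cycPeakPoly {K : Type*} [CommSemiring K] (n : ℕ) (q x t : K) : K :=
  ∑ σ : Equiv.Perm (Fin n), q ^ (cycStar σ - fixStar σ) * x ^ cpkStar σ * t ^ exc σ

end StarStat

/-! Both identities are instances of one scaling law: `P_n(q, x, t)` is a combination of products
`(xt)^i (1+t)^(n-1-2i)` whose coefficients depend only on `q`. Hence `xt = r² x't'` and `1+t =
r(1+t')` give `P_n(q, x, t) = r^(n-1) P_n(q, x', t')` (`cycPeakPoly_scale`), and `A_n` is the case
`x = 1`.

For the expansion, write `σ` as `ρ` composed with the cyclic rotation; then `σ*` is `ρ` with a new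
largest letter inserted right after `0` (`star_mul_finRotate`), and the statistics of `σ` become
local weights on the nonzero letters of `ρ`. With five independent weights, inserting a largest
letter acts on the generating sum as `W ↦ (fixed + descent) W + δ W` for a derivation `δ`
(`weightSum_succ`). This operator preserves polynomials in `peak * valley`, `ascent + descent` and
`fixed + descent`, which specialise to `xt`, `1+t` and `1+t`. -/

namespace StarStat

open Finset Equiv

/-! ### Effect of a transposition with a fixed point on the number of nontrivial cycles. -/

section Insertion

variable {α : Type*} [Fintype α] [DecidableEq α]

theorem card_cycleType_swap_mul_of_fixed {τ : Perm α} {x y : α} (hxy : x ≠ y)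
    (hx : τ x = x) (hy : τ y = y) :
    Multiset.card (swap x y * τ).cycleType = Multiset.card τ.cycleType + 1 := by
  have hd : Perm.Disjoint (swap x y) τ := by
    intro z
    by_cases hzx : z = x
    · exact Or.inr (hzx ▸ hx)
    by_cases hzy : z = y
    · exact Or.inr (hzy ▸ hy)
    exact Or.inl (swap_apply_of_ne_of_ne hzx hzy)
  rw [hd.cycleType_mul, Multiset.card_add, (Perm.isCycle_swap hxy).cycleType]
  simp [add_comm]

/-- In list form, the cycle `(y, l)` becomes the cycle `(x, y, l)`. -/
theorem isCycle_swap_mul_cycleOf {τ : Perm α} {x y : α} (hx : τ x = x) (hy : τ y ≠ y) :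
    (swap x y * τ.cycleOf y).IsCycle := by
  have hy' : y ∈ τ.support := Perm.mem_support.2 hy
  have hlen := Perm.two_le_length_toList_iff_mem_support.2 hy'
  have hhead := Perm.toList_getElem_zero τ y hy'
  have hnd := Perm.nodup_toList τ y
  have hform := Perm.formPerm_toList τ y
  have hxl : x ∉ Perm.toList τ y := by
    rw [Perm.mem_toList_iff]
    rintro ⟨h, -⟩
    exact hy (by rw [← h.apply_eq_self_iff] at hx; exact hx)
  cases hl : Perm.toList τ y with
  | nil => simp [hl] at hlen
  | cons a l =>
    have ha : a = y := by simpa [hl] using hhead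
    subst ha
    rw [← hform, hl, ← List.formPerm_cons_cons]
    rw [hl] at hxl hnd
    exact List.isCycle_formPerm (List.nodup_cons.2 ⟨hxl, hnd⟩) (by simp)

theorem card_cycleType_swap_mul_of_moved {τ : Perm α} {x y : α}
    (hx : τ x = x) (hy : τ y ≠ y) :
    Multiset.card (swap x y * τ).cycleType = Multiset.card τ.cycleType := by
  set c := τ.cycleOf y with hcdef
  have hc : c.IsCycle := Perm.isCycle_cycleOf τ hy
  have hcy : c y ≠ y := by rwa [hcdef, Perm.cycleOf_apply_self]
  have hcx : c x = x := by
    rw [← Perm.notMem_support]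
    exact fun h => Perm.mem_support.1 (Perm.support_cycleOf_le τ y h) hx
  have hd : Perm.Disjoint (τ * c⁻¹) c := Perm.disjoint_mul_inv_of_mem_cycleFactorsFinset
    (Perm.cycleOf_mem_cycleFactorsFinset_iff.2 (Perm.mem_support.2 hy))
  have hτ : τ = c * (τ * c⁻¹) := by rw [← hd.commute.eq]; simp
  have hd' : Perm.Disjoint (swap x y * c) (τ * c⁻¹) := by
    intro z
    by_cases hzx : z = x
    · right
      subst hzx
      have : c⁻¹ z = z := by rw [Perm.inv_eq_iff_eq, hcx]
      rw [Perm.mul_apply, this, hx]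
    rcases hd z with h | h
    · exact Or.inr h
    · left
      have hzy : z ≠ y := fun h' => hcy (h' ▸ h)
      simp [h, swap_apply_of_ne_of_ne hzx hzy]
  conv_rhs => rw [hτ, hd.symm.cycleType_mul, hc.cycleType]
  conv_lhs => rw [hτ, ← mul_assoc, hd'.cycleType_mul, (isCycle_swap_mul_cycleOf hx hy).cycleType]
  simp

end Insertion

/-! ### Building permutations by inserting a largest letter. -/

section InsertLast

variable {n : ℕ}

/-- The extension of a permutation of `Fin n` to `Fin (n + 1)` fixing the last element. -/
def extendLast (ρ : Perm (Fin n)) : Perm (Fin (n + 1)) :=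
  ρ.extendDomain (finSuccAboveEquiv (Fin.last n))

@[simp]
theorem extendLast_castSucc (ρ : Perm (Fin n)) (i : Fin n) :
    extendLast ρ i.castSucc = (ρ i).castSucc := by
  have h := Perm.extendDomain_apply_image ρ (finSuccAboveEquiv (Fin.last n)) i
  simpa [extendLast, finSuccAboveEquiv_apply] using h

@[simp]
theorem extendLast_last (ρ : Perm (Fin n)) : extendLast ρ (Fin.last n) = Fin.last n :=
  Perm.extendDomain_apply_not_subtype _ _ (by simp)

theorem cycleType_extendLast (ρ : Perm (Fin n)) : (extendLast ρ).cycleType = ρ.cycleType :=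
  Perm.cycleType_extendDomain _

/-- Insert a new largest element into the cycles of `ρ`, just before `b`; if `b` is the new element
itself, it becomes a fixed point. -/
def insertLast (b : Fin (n + 1)) (ρ : Perm (Fin n)) : Perm (Fin (n + 1)) :=
  swap (Fin.last n) b * extendLast ρ

@[simp]
theorem insertLast_apply_last (b : Fin (n + 1)) (ρ : Perm (Fin n)) :
    insertLast b ρ (Fin.last n) = b := by
  simp [insertLast]

theorem insertLast_apply_castSucc (b : Fin (n + 1)) (ρ : Perm (Fin n)) (i : Fin n) :
    insertLast b ρ i.castSucc = if (ρ i).castSucc = b then Fin.last n else (ρ i).castSucc := by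
  simp [insertLast, swap_apply_def, (Fin.castSucc_lt_last _).ne]

theorem extendLast_symm (ρ : Perm (Fin n)) : (extendLast ρ).symm = extendLast ρ.symm :=
  Perm.extendDomain_inv ρ _

theorem insertLast_symm (b : Fin (n + 1)) (ρ : Perm (Fin n)) :
    (insertLast b ρ).symm = (swap (Fin.last n) b).trans (extendLast ρ.symm) := by
  rw [← extendLast_symm, ← symm_swap (Fin.last n) b, ← Equiv.symm_trans]
  rfl

theorem insertLast_symm_apply_last (b : Fin (n + 1)) (ρ : Perm (Fin n)) :
    (insertLast b ρ).symm (Fin.last n) = extendLast ρ.symm b := by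
  simp [insertLast_symm]

theorem insertLast_symm_apply_castSucc (b : Fin (n + 1)) (ρ : Perm (Fin n)) (i : Fin n) :
    (insertLast b ρ).symm i.castSucc =
      if i.castSucc = b then Fin.last n else (ρ.symm i).castSucc := by
  simp only [insertLast_symm, trans_apply, swap_apply_def, (Fin.castSucc_lt_last _).ne, if_false]
  split_ifs <;> simp

theorem insertLast_last (ρ : Perm (Fin n)) : insertLast (Fin.last n) ρ = extendLast ρ := by
  rw [insertLast, swap_self, ← Perm.one_def, one_mul]

theorem insertLast_bijective :
    Function.Bijective fun p : Fin (n + 1) × Perm (Fin n) => insertLast p.1 p.2 := by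
  rw [Fintype.bijective_iff_injective_and_card]
  refine ⟨?_, by simp [Fintype.card_perm, Nat.factorial_succ]⟩
  rintro ⟨b, ρ⟩ ⟨b', ρ'⟩ h
  have hb : b = b' := by simpa using congrArg (· (Fin.last n)) h
  subst hb
  have h' : extendLast ρ = extendLast ρ' := mul_left_cancel h
  rw [Prod.mk.injEq]
  refine ⟨rfl, Equiv.ext fun i => ?_⟩
  simpa using congrArg (· i.castSucc) h'

theorem sum_perm_succ {R : Type*} [AddCommMonoid R] (f : Perm (Fin (n + 1)) → R) :
    ∑ τ, f τ =
      ∑ ρ : Perm (Fin n), (f (extendLast ρ) + ∑ b : Fin n, f (insertLast b.castSucc ρ)) := by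
  rw [← (Equiv.ofBijective _ (insertLast_bijective (n := n))).sum_comp, Fintype.sum_prod_type_right]
  refine sum_congr rfl fun ρ _ => ?_
  rw [Fin.sum_univ_castSucc, add_comm]
  simp [insertLast_last]

theorem card_cycleType_insertLast_castSucc (b : Fin n) (ρ : Perm (Fin n)) :
    Multiset.card (insertLast b.castSucc ρ).cycleType =
      Multiset.card ρ.cycleType + if ρ b = b then 1 else 0 := by
  rw [← cycleType_extendLast ρ, insertLast]
  split_ifs with h
  · exact card_cycleType_swap_mul_of_fixed (Fin.castSucc_lt_last _).ne' (by simp) (by simp [h])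
  · exact card_cycleType_swap_mul_of_moved (by simp) (by simpa using h)

end InsertLast

/-! ### Cycle count under insertion. -/

section CycleCount

variable {n : ℕ}

/-- The number of cycles of `ρ`, not counting fixed points other than `0`. -/
def cycleCount (ρ : Perm (Fin (n + 1))) : ℕ :=
  Multiset.card ρ.cycleType + if ρ 0 = 0 then 1 else 0

theorem cycleCount_extendLast (ρ : Perm (Fin (n + 1))) :
    cycleCount (extendLast ρ) = cycleCount ρ := by
  have h : extendLast ρ 0 = (ρ 0).castSucc := extendLast_castSucc ρ 0
  simp [cycleCount, cycleType_extendLast, h]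

/-- Only opening a fixed point creates a new nontrivial cycle; a fixed `0` is exempt because it is
counted already. -/
theorem cycleCount_insertLast (b : Fin (n + 1)) (ρ : Perm (Fin (n + 1))) :
    cycleCount (insertLast b.castSucc ρ) =
      cycleCount ρ + if ρ b = b ∧ b ≠ 0 then 1 else 0 := by
  have h : insertLast b.castSucc ρ 0 =
      if (ρ 0).castSucc = b.castSucc then Fin.last _ else (ρ 0).castSucc :=
    insertLast_apply_castSucc _ ρ 0
  rw [cycleCount, card_cycleType_insertLast_castSucc, h, cycleCount]
  by_cases hb : b = 0
  · subst hb
    by_cases h0 : ρ 0 = 0 <;> simp [h0]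
  · by_cases h0 : ρ 0 = b
    · have : ρ b ≠ b := fun h' => hb (ρ.injective (h'.trans h0.symm))
      simp [h0, this, hb]
    · simp [h0, hb]
      omega

end CycleCount

/-! ### Letter weights and their local change under insertion. -/

section Weight

theorem derivation_prod {K R ι : Type*} [CommSemiring K] [CommSemiring R] [Algebra K R]
    [DecidableEq ι] (δ : Derivation K R R) (s : Finset ι) (f : ι → R) :
    δ (∏ i ∈ s, f i) = ∑ i ∈ s, (∏ j ∈ s.erase i, f j) * δ (f i) := by
  induction s using Finset.induction_on with
  | empty => simp
  | insert a s ha ih =>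
    rw [prod_insert ha, Derivation.leibniz, ih, sum_insert ha, erase_insert ha, add_comm,
      smul_eq_mul, smul_eq_mul, mul_sum]
    refine congrArg₂ _ rfl (sum_congr rfl fun i hi => ?_)
    have hia : i ≠ a := fun h => ha (h ▸ hi)
    rw [erase_insert_of_ne hia.symm, prod_insert (by simp [ha]), mul_assoc]

/-- Weights attached to peaks, valleys, double ascents, double descents and fixed points. -/
structure Weights (R : Type*) where
  peak : R
  valley : R
  ascent : R
  descent : R
  fixed : R

variable {n : ℕ} {R : Type*} (w : Weights R)

/-- The weight of the letter `i` in the cycles of `ρ`, where `0` counts as larger than `i` when it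
precedes `i` and as smaller than `i` when it follows `i`. -/
def letterWeight (ρ : Perm (Fin (n + 1))) (i : Fin (n + 1)) : R :=
  if ρ i = i then w.fixed
  else if ρ.symm i = 0 ∨ i < ρ.symm i then (if i < ρ i then w.valley else w.descent)
  else if i < ρ i then w.ascent else w.peak

theorem inv_insertLast_castSucc_above_iff (b : Fin (n + 2)) (ρ : Perm (Fin (n + 1)))
    (j : Fin (n + 1)) :
    ((insertLast b ρ).symm j.castSucc = 0 ∨ j.castSucc < (insertLast b ρ).symm j.castSucc) ↔
      j.castSucc = b ∨ (ρ.symm j = 0 ∨ j < ρ.symm j) := by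
  rw [insertLast_symm_apply_castSucc]
  split_ifs with h
  · simp [h.symm, Fin.castSucc_lt_last]
  · simp [h]

theorem castSucc_lt_insertLast_iff (b : Fin (n + 2)) (ρ : Perm (Fin (n + 1))) (j : Fin (n + 1)) :
    j.castSucc < insertLast b ρ j.castSucc ↔ (ρ j).castSucc = b ∨ j < ρ j := by
  rw [insertLast_apply_castSucc]
  split_ifs with h
  · simp [h, Fin.castSucc_lt_last]
  · simp [h]

theorem insertLast_castSucc_eq_iff (b : Fin (n + 2)) (ρ : Perm (Fin (n + 1))) (j : Fin (n + 1)) :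
    insertLast b ρ j.castSucc = j.castSucc ↔ ρ j = j ∧ j.castSucc ≠ b := by
  rw [insertLast_apply_castSucc]
  split_ifs with h
  · simp only [(Fin.castSucc_lt_last j).ne', false_iff, not_and, not_not]
    exact fun h' => by rw [← h, h']
  · simp only [Fin.castSucc_inj]
    exact ⟨fun h' => ⟨h', fun h'' => h (by rw [h', h''])⟩, And.left⟩

theorem letterWeight_insertLast_castSucc (b : Fin (n + 2)) (ρ : Perm (Fin (n + 1)))
    (j : Fin (n + 1)) :
    letterWeight w (insertLast b ρ) j.castSucc =
      if ρ j = j ∧ j.castSucc ≠ b then w.fixed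
      else if j.castSucc = b ∨ (ρ.symm j = 0 ∨ j < ρ.symm j) then
        (if (ρ j).castSucc = b ∨ j < ρ j then w.valley else w.descent)
      else if (ρ j).castSucc = b ∨ j < ρ j then w.ascent else w.peak := by
  simp only [letterWeight, inv_insertLast_castSucc_above_iff, castSucc_lt_insertLast_iff,
    insertLast_castSucc_eq_iff]

theorem letterWeight_insertLast_last (b : Fin (n + 1)) (ρ : Perm (Fin (n + 1))) :
    letterWeight w (insertLast b.castSucc ρ) (Fin.last _) =
      if ρ.symm b = 0 then w.descent else w.peak := by
  simp [letterWeight, insertLast_symm_apply_last, (Fin.castSucc_lt_last b).ne,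
    (Fin.castSucc_lt_last b).not_gt, (Fin.castSucc_lt_last (ρ.symm b)).not_gt]

theorem letterWeight_extendLast_castSucc (ρ : Perm (Fin (n + 1))) (j : Fin (n + 1)) :
    letterWeight w (extendLast ρ) j.castSucc = letterWeight w ρ j := by
  rw [← insertLast_last, letterWeight_insertLast_castSucc]
  simp [letterWeight, (Fin.castSucc_lt_last _).ne]

theorem letterWeight_extendLast_last (ρ : Perm (Fin (n + 1))) :
    letterWeight w (extendLast ρ) (Fin.last _) = w.fixed := by
  simp [letterWeight]

/-- Replacing a neighbour of `j` by the largest letter changes nothing if that neighbour already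
counted as larger than `j`. -/
theorem letterWeight_insertLast_of_ne {b : Fin (n + 1)} {ρ : Perm (Fin (n + 1))} {j : Fin (n + 1)}
    (hout : ρ j = b → j < b) (hin : j = b → ρ j ≠ j ∧ (ρ.symm j = 0 ∨ j < ρ.symm j)) :
    letterWeight w (insertLast b.castSucc ρ) j.castSucc = letterWeight w ρ j := by
  rw [letterWeight_insertLast_castSucc, letterWeight]
  simp only [Fin.castSucc_inj, ne_eq]
  by_cases h1 : j = b
  · obtain ⟨h2, h3⟩ := hin h1
    have h4 : ρ j ≠ b := h1 ▸ h2
    simp [h2, h3, h4]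
  · by_cases h2 : ρ j = b
    · have h3 := hout h2
      have h4 : ρ j ≠ j := by rw [h2]; exact Ne.symm h1
      simp [h1, h2, h3, Ne.symm h1]
    · simp [h1, h2]

variable [CommSemiring R]

/-- The product of the letter weights over all letters other than `0`. -/
def permWeight (ρ : Perm (Fin (n + 1))) : R :=
  ∏ i : Fin n, letterWeight w ρ i.succ

theorem permWeight_extendLast (ρ : Perm (Fin (n + 1))) :
    permWeight w (extendLast ρ) = w.fixed * permWeight w ρ := by
  rw [permWeight, Fin.prod_univ_castSucc, permWeight, mul_comm, Fin.succ_last,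
    letterWeight_extendLast_last]
  simp_rw [Fin.succ_castSucc, letterWeight_extendLast_castSucc]

theorem permWeight_insertLast (b : Fin (n + 1)) (ρ : Perm (Fin (n + 1))) :
    permWeight w (insertLast b.castSucc ρ) =
      (∏ i : Fin n, letterWeight w (insertLast b.castSucc ρ) i.succ.castSucc) *
        if ρ.symm b = 0 then w.descent else w.peak := by
  rw [permWeight, Fin.prod_univ_castSucc, Fin.succ_last, letterWeight_insertLast_last]
  simp_rw [Fin.succ_castSucc]

theorem permWeight_insertLast_apply_zero (ρ : Perm (Fin (n + 1))) :
    permWeight w (insertLast (ρ 0).castSucc ρ) = w.descent * permWeight w ρ := by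
  rw [permWeight_insertLast, permWeight, mul_comm]
  simp only [symm_apply_apply, if_true]
  congr 1
  refine prod_congr rfl fun i _ => letterWeight_insertLast_of_ne w ?_ ?_
  · intro h
    exact absurd (ρ.injective h) (Fin.succ_ne_zero i)
  · intro h
    refine ⟨fun h' => ?_, Or.inl (by rw [h, symm_apply_apply])⟩
    exact Fin.succ_ne_zero i (ρ.injective (h'.trans h))

/-- Inserting a new largest letter just after a letter `i` that is followed by a smaller letter, or
that is fixed. -/
theorem permWeight_insertLast_after {ρ : Perm (Fin (n + 1))} {i : Fin n}
    (hi : ρ i.succ ≤ i.succ) :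
    permWeight w (insertLast (ρ i.succ).castSucc ρ) =
      (∏ j ∈ univ.erase i, letterWeight w ρ j.succ) *
        ((if ρ i.succ = i.succ ∨ ρ.symm i.succ = 0 ∨ i.succ < ρ.symm i.succ then w.valley
          else w.ascent) * w.peak) := by
  rw [permWeight_insertLast, ← prod_erase_mul _ _ (mem_univ i), mul_assoc,
    letterWeight_insertLast_castSucc, symm_apply_apply, if_neg (Fin.succ_ne_zero i)]
  congr 1
  · refine prod_congr rfl fun j hj => letterWeight_insertLast_of_ne w ?_ ?_
    · intro h
      exact absurd (Fin.succ_injective _ (ρ.injective h)) (ne_of_mem_erase hj)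
    · intro h
      have hne : i.succ ≠ j.succ := fun h' => ne_of_mem_erase hj (Fin.succ_injective _ h').symm
      refine ⟨fun h' => hne (ρ.injective (h.symm.trans h'.symm)), Or.inr ?_⟩
      rw [h, symm_apply_apply]
      exact lt_of_le_of_ne hi fun h' => hne (h'.symm.trans h.symm)
  · simp only [Fin.castSucc_inj]
    by_cases h : ρ i.succ = i.succ
    · simp [h]
    · simp [h, Ne.symm h]

/-- Inserting a new largest letter just before a letter `i` that is preceded by a smaller letter. -/
theorem permWeight_insertLast_before {ρ : Perm (Fin (n + 1))} {i : Fin n}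
    (h0 : ρ.symm i.succ ≠ 0) (hi : ρ.symm i.succ < i.succ) :
    permWeight w (insertLast i.succ.castSucc ρ) =
      (∏ j ∈ univ.erase i, letterWeight w ρ j.succ) *
        ((if i.succ < ρ i.succ then w.valley else w.descent) * w.peak) := by
  rw [permWeight_insertLast, ← prod_erase_mul _ _ (mem_univ i), mul_assoc,
    letterWeight_insertLast_castSucc, if_neg h0]
  congr 1
  · refine prod_congr rfl fun j hj => letterWeight_insertLast_of_ne w ?_ ?_
    · intro h
      rwa [← h, symm_apply_apply, h] at hi
    · intro h
      exact absurd (Fin.succ_injective _ h) (ne_of_mem_erase hj)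
  · have h : ρ i.succ ≠ i.succ := by
      intro h
      rw [(symm_apply_eq _).2 h.symm] at hi
      exact hi.false
    simp only [Fin.castSucc_inj]
    simp [h]

/-- Insertion places are the arrows `a → ρ a`. The arrow out of `0` stands apart; every other one is
charged to its larger endpoint, the only old letter whose weight can change. -/
theorem sum_univ_eq_sum_after_add_before {M : Type*} [AddCommMonoid M] (ρ : Perm (Fin (n + 1)))
    (f : Fin (n + 1) → M) :
    ∑ b, f b = f (ρ 0) + ∑ i : Fin n,
      ((if ρ i.succ ≤ i.succ then f (ρ i.succ) else 0) +
        if ρ.symm i.succ ≠ 0 ∧ ρ.symm i.succ < i.succ then f i.succ else 0) := by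
  have h1 : ∑ a, (if a = 0 ∨ ρ a ≤ a then f (ρ a) else 0) =
      ∑ b, if ρ.symm b = 0 ∨ b ≤ ρ.symm b then f b else 0 := by
    rw [← Equiv.sum_comp ρ fun b => if ρ.symm b = 0 ∨ b ≤ ρ.symm b then f b else 0]
    simp
  have h2 : ∑ b, f b = ∑ b, ((if ρ.symm b = 0 ∨ b ≤ ρ.symm b then f b else 0) +
      if ρ.symm b ≠ 0 ∧ ρ.symm b < b then f b else 0) := by
    refine sum_congr rfl fun b _ => ?_
    by_cases h : ρ.symm b = 0 ∨ b ≤ ρ.symm b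
    · rw [if_pos h, if_neg, add_zero]
      push Not
      exact fun h' => h.resolve_left h'
    · rw [if_neg h, if_pos, zero_add]
      push Not at h
      exact h
  rw [h2, sum_add_distrib, ← h1, Fin.sum_univ_succ, Fin.sum_univ_succ, sum_add_distrib]
  simp [add_assoc]

end Weight

/-! ### The insertion recursion. -/

section Recursion

variable {n : ℕ} {K R : Type*} [CommSemiring K] [CommSemiring R] [Algebra K R]
  (w : Weights R) (q : K)

/-- The sum over all permutations of `q ^ cycleCount` times the product of the letter weights. -/
def weightSum (n : ℕ) : R :=
  ∑ ρ : Perm (Fin (n + 1)), q ^ cycleCount ρ • permWeight w ρ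

/-- The factor `fixed + descent` comes from the new letter being a fixed point or following `0`. At
any other place it is a peak: an old peak becomes an ascent or a descent, an ascent or descent
becomes a valley, a fixed point becomes a valley in a new cycle (hence `q`), and a valley is charged
with no place. Summing over letters is the Leibniz rule. -/
theorem weightSum_succ (δ : Derivation K R R)
    (hpeak : δ w.peak = w.peak * (w.ascent + w.descent)) (hvalley : δ w.valley = 0)
    (hascent : δ w.ascent = w.peak * w.valley) (hdescent : δ w.descent = w.peak * w.valley)
    (hfixed : δ w.fixed = q • (w.peak * w.valley)) :
    weightSum w q (n + 1) = (w.fixed + w.descent) * weightSum w q n + δ (weightSum w q n) := by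
  rw [weightSum, sum_perm_succ, weightSum, mul_sum, map_sum, ← sum_add_distrib]
  refine sum_congr rfl fun ρ _ => ?_
  rw [cycleCount_extendLast, permWeight_extendLast, sum_univ_eq_sum_after_add_before ρ,
    Derivation.map_smul, permWeight_insertLast_apply_zero, cycleCount_insertLast, add_mul,
    permWeight, derivation_prod, smul_sum, ← add_assoc, mul_smul_comm, mul_smul_comm]
  have h0 : ¬ (ρ (ρ 0) = ρ 0 ∧ ρ 0 ≠ 0) := fun h => h.2 (ρ.injective h.1)
  rw [if_neg h0, add_zero]
  congr 1
  refine sum_congr rfl fun i _ => ?_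
  rw [cycleCount_insertLast, cycleCount_insertLast]
  by_cases hf : ρ i.succ = i.succ
  · have hf' : ρ.symm i.succ = i.succ := (symm_apply_eq _).2 hf.symm
    have h := permWeight_insertLast_after w hf.le
    rw [hf] at h
    simp only [hf, le_refl, if_true, h, hf', lt_irrefl, and_false, if_false, add_zero, true_or,
      letterWeight, hfixed, Fin.succ_ne_zero, ne_eq, not_false_eq_true, and_self, mul_smul_comm,
      pow_succ, mul_smul]
    ring_nf
  · have hf' : ρ.symm i.succ ≠ i.succ := fun h => hf ((symm_apply_eq _).1 h).symm
    have hff : ρ (ρ i.succ) ≠ ρ i.succ := fun h => hf (ρ.injective h)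
    have hP : (if ρ i.succ ≤ i.succ then q ^ (cycleCount ρ +
          if ρ (ρ i.succ) = ρ i.succ ∧ ρ i.succ ≠ 0 then 1 else 0) •
          permWeight w (insertLast (ρ i.succ).castSucc ρ) else 0) =
        q ^ cycleCount ρ • ((∏ j ∈ univ.erase i, letterWeight w ρ j.succ) *
          if i.succ < ρ i.succ then 0 else
            (if ρ.symm i.succ = 0 ∨ i.succ < ρ.symm i.succ then w.valley else w.ascent) * w.peak) := by
      by_cases h : i.succ < ρ i.succ
      · simp [h]
      · rw [if_neg h, if_pos (not_lt.1 h), permWeight_insertLast_after w (not_lt.1 h)]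
        simp [hf, hff]
    have hQ : (if ρ.symm i.succ ≠ 0 ∧ ρ.symm i.succ < i.succ then q ^ (cycleCount ρ +
          if ρ i.succ = i.succ ∧ i.succ ≠ 0 then 1 else 0) •
          permWeight w (insertLast i.succ.castSucc ρ) else 0) =
        q ^ cycleCount ρ • ((∏ j ∈ univ.erase i, letterWeight w ρ j.succ) *
          if ρ.symm i.succ = 0 ∨ i.succ < ρ.symm i.succ then 0 else
            (if i.succ < ρ i.succ then w.valley else w.descent) * w.peak) := by
      by_cases h : ρ.symm i.succ = 0 ∨ i.succ < ρ.symm i.succ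
      · rw [if_neg, if_pos h]
        · simp
        · rintro ⟨h1, h2⟩
          exact h.elim h1 h2.not_gt
      · have h' := not_or.1 h
        have h2 := lt_of_le_of_ne (not_lt.1 h'.2) hf'
        rw [if_neg h, if_pos ⟨h'.1, h2⟩, permWeight_insertLast_before w h'.1 h2]
        simp [hf]
    rw [hP, hQ, ← smul_add, ← mul_add, letterWeight, if_neg hf]
    congr 2
    split_ifs <;> simp only [hpeak, hvalley, hascent, hdescent] <;> ring

end Recursion

/-! ### The invariant graded span and the scaling law. -/

section Homogeneity

open MvPolynomial

variable {K : Type*} [CommRing K] (q : K)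

/-- The weights given by five independent indeterminates. -/
noncomputable def genericWeights (K : Type*) [CommRing K] : Weights (MvPolynomial (Fin 5) K) :=
  ⟨X 0, X 1, X 2, X 3, X 4⟩

/-- The derivation of the polynomial ring that describes the insertion of a new largest letter. -/
noncomputable def insertionDerivation :
    Derivation K (MvPolynomial (Fin 5) K) (MvPolynomial (Fin 5) K) :=
  mkDerivation K ![X 0 * (X 2 + X 3), 0, X 0 * X 1, X 0 * X 1, q • (X 0 * X 1)]

/-- The polynomials that are homogeneous of degree `m` in `peak * valley` (of degree two),
`ascent + descent` and `fixed + descent`. -/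
noncomputable def gammaSpan (K : Type*) [CommRing K] (m : ℕ) :
    Submodule K (MvPolynomial (Fin 5) K) :=
  Submodule.span K {p | ∃ i j k : ℕ, 2 * i + j + k = m ∧
    p = (X 0 * X 1) ^ i * (X 2 + X 3) ^ j * (X 4 + X 3) ^ k}

theorem monomial_mem_gammaSpan {m : ℕ} (i j k : ℕ) (h : 2 * i + j + k = m) :
    ((X 0 * X 1) ^ i * (X 2 + X 3) ^ j * (X 4 + X 3) ^ k : MvPolynomial (Fin 5) K) ∈
      gammaSpan K m :=
  Submodule.subset_span ⟨i, j, k, h, rfl⟩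

theorem insertionDerivation_pow_succ (p : MvPolynomial (Fin 5) K) (m : ℕ) :
    insertionDerivation q (p ^ (m + 1)) = ((m + 1 : ℕ) : K) • (p ^ m * insertionDerivation q p) := by
  rw [Derivation.leibniz_pow, Nat.cast_smul_eq_nsmul]
  simp

theorem mul_add_insertionDerivation_mem_gammaSpan {m : ℕ} {p : MvPolynomial (Fin 5) K}
    (hp : p ∈ gammaSpan K m) :
    (X 4 + X 3) * p + insertionDerivation q p ∈ gammaSpan K (m + 1) := by
  have h0 : insertionDerivation q (X 0 * X 1) = X 0 * X 1 * (X 2 + X 3) := by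
    simp [insertionDerivation, mkDerivation_X]
    ring
  have h1 : insertionDerivation q (X 2 + X 3) = (2 : K) • (X 0 * X 1) := by
    simp [insertionDerivation, mkDerivation_X, two_smul]
  have h2 : insertionDerivation q (X 4 + X 3) = (q + 1) • (X 0 * X 1) := by
    simp [insertionDerivation, mkDerivation_X, add_smul]
  induction hp using Submodule.span_induction with
  | zero => simp
  | add p p' _ _ hp hp' =>
    rw [mul_add, map_add, add_add_add_comm]
    exact add_mem hp hp'
  | smul c p _ hp =>
    rw [Derivation.map_smul, mul_smul_comm, ← smul_add]
    exact Submodule.smul_mem _ _ hp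
  | mem p hp =>
    obtain ⟨i, j, k, rfl, rfl⟩ := hp
    rw [Derivation.leibniz, Derivation.leibniz]
    simp only [smul_eq_mul, mul_add]
    -- `hX`, `hY`, `hZ` are the Leibniz terms, one per generator; in each, the derivation raises the
    -- weighted degree by exactly one.
    have hX : ∀ i j k, ((X 0 * X 1) ^ i * (X 2 + X 3) ^ j * insertionDerivation q ((X 4 + X 3) ^ k) :
        MvPolynomial (Fin 5) K) ∈ gammaSpan K (2 * i + j + k + 1) := by
      rintro i j (_ | k)
      · simp
      · rw [insertionDerivation_pow_succ, h2, mul_smul_comm, mul_smul_comm, mul_smul_comm]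
        refine Submodule.smul_mem _ _ (Submodule.smul_mem _ _ ?_)
        convert monomial_mem_gammaSpan (K := K) (m := 2 * i + j + (k + 1) + 1) (i + 1) j k (by ring)
          using 1
        ring
    have hY : ∀ i j k, ((X 4 + X 3) ^ k * ((X 0 * X 1) ^ i * insertionDerivation q ((X 2 + X 3) ^ j)) :
        MvPolynomial (Fin 5) K) ∈ gammaSpan K (2 * i + j + k + 1) := by
      rintro i (_ | j) k
      · simp
      · rw [insertionDerivation_pow_succ, h1, mul_smul_comm, mul_smul_comm, mul_smul_comm,
          mul_smul_comm, mul_smul_comm]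
        refine Submodule.smul_mem _ _ (Submodule.smul_mem _ _ ?_)
        convert monomial_mem_gammaSpan (K := K) (m := 2 * i + (j + 1) + k + 1) (i + 1) j k (by ring)
          using 1
        ring
    have hZ : ∀ i j k, ((X 4 + X 3) ^ k * ((X 2 + X 3) ^ j * insertionDerivation q ((X 0 * X 1) ^ i)) :
        MvPolynomial (Fin 5) K) ∈ gammaSpan K (2 * i + j + k + 1) := by
      rintro (_ | i) j k
      · simp
      · rw [insertionDerivation_pow_succ, h0, mul_smul_comm, mul_smul_comm]
        refine Submodule.smul_mem _ _ ?_
        convert monomial_mem_gammaSpan (K := K) (m := 2 * (i + 1) + j + k + 1) (i + 1) (j + 1) k (by ring)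
          using 1
        ring
    have hT : ((X 4 + X 3) * ((X 0 * X 1) ^ i * (X 2 + X 3) ^ j * (X 4 + X 3) ^ k) :
        MvPolynomial (Fin 5) K) ∈ gammaSpan K (2 * i + j + k + 1) := by
      convert monomial_mem_gammaSpan (K := K) (m := 2 * i + j + k + 1) i j (k + 1) (by ring)
          using 1
      ring
    exact add_mem hT (add_mem (hX i j k) (add_mem (hY i j k) (hZ i j k)))

theorem weightSum_genericWeights_mem_gammaSpan (n : ℕ) :
    weightSum (genericWeights K) q n ∈ gammaSpan K n := by
  induction n with
  | zero =>
    have h := monomial_mem_gammaSpan (K := K) 0 0 0 rfl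
    rw [pow_zero, pow_zero, pow_zero, one_mul, one_mul] at h
    refine Submodule.sum_mem _ fun ρ _ => Submodule.smul_mem _ _ ?_
    simpa [permWeight] using h
  | succ n ih =>
    rw [weightSum_succ _ _ (insertionDerivation q)]
    · exact mul_add_insertionDerivation_mem_gammaSpan q ih
    all_goals simp [insertionDerivation, genericWeights, mkDerivation_X]

/-- The weights that record the peaks by `x`, and the weak excedances by `t`. -/
def peakExcWeights (x t : K) : Weights K := ⟨x, t, t, 1, t⟩

theorem eval_permWeight_genericWeights {n : ℕ} (x t : K) (ρ : Perm (Fin (n + 1))) :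
    eval ![x, t, t, 1, t] (permWeight (genericWeights K) ρ) = permWeight (peakExcWeights x t) ρ := by
  rw [permWeight, map_prod, permWeight]
  refine prod_congr rfl fun i _ => ?_
  rw [letterWeight, letterWeight]
  split_ifs <;> simp [genericWeights, peakExcWeights]

theorem eval_weightSum_genericWeights (n : ℕ) (x t : K) :
    eval ![x, t, t, 1, t] (weightSum (genericWeights K) q n) =
      weightSum (peakExcWeights x t) q n := by
  rw [weightSum, map_sum, weightSum]
  refine sum_congr rfl fun ρ _ => ?_
  rw [smul_eval, eval_permWeight_genericWeights, smul_eq_mul]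

theorem weightSum_peakExcWeights_scale (n : ℕ) {x t x' t' r : K}
    (h1 : x * t = r ^ 2 * (x' * t')) (h2 : 1 + t = r * (1 + t')) :
    weightSum (peakExcWeights x t) q n = r ^ n * weightSum (peakExcWeights x' t') q n := by
  rw [← eval_weightSum_genericWeights, ← eval_weightSum_genericWeights]
  have hG := weightSum_genericWeights_mem_gammaSpan q n
  generalize weightSum (genericWeights K) q n = p at hG ⊢
  induction hG using Submodule.span_induction with
  | zero => simp
  | add p p' _ _ hp hp' => rw [map_add, map_add, hp, hp', mul_add]
  | smul c p _ hp => rw [smul_eval, smul_eval, hp, mul_left_comm]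
  | mem p hp =>
    obtain ⟨i, j, k, rfl, rfl⟩ := hp
    -- Both degree-one generators evaluate to `t + 1`, so each scales by `r`, while `peak * valley`
    -- scales by `r ^ 2`.
    have h3 : t + 1 = r * (t' + 1) := by linear_combination h2
    simp only [map_mul, map_pow, map_add, eval_X, Matrix.cons_val, h1, h3]
    simp only [mul_pow]
    ring

end Homogeneity

/-! ### Translation between star statistics and letter weights. -/

section StarCompanion

variable {n : ℕ}

theorem star_mul_finRotate (ρ : Perm (Fin (n + 1))) :
    star (ρ * finRotate (n + 1)) = insertLast (ρ 0).castSucc ρ := by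
  ext1 i
  refine Fin.cases ?_ (fun j => ?_) i
  · exact ((insertLast_apply_castSucc _ ρ 0).trans (if_pos rfl)).symm
  · have h : star (ρ * finRotate (n + 1)) j.succ = (ρ (finRotate (n + 1) j)).castSucc := by
      simp [star]
    rw [h]
    refine Fin.lastCases ?_ (fun k => ?_) j
    · simp
    · have hk : finRotate (n + 1) k.castSucc = k.succ := by simp
      rw [hk, Fin.succ_castSucc, insertLast_apply_castSucc, if_neg]
      simp

/-- Since `σ*` sends `0` to the largest letter, neither extreme letter is fixed, so the range
restriction is automatic. -/
theorem FixStar_eq_filter (σ : Perm (Fin (n + 1))) :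
    FixStar σ = ({i | star σ i = i} : Finset (Fin (n + 1 + 1))) := by
  ext i
  simp only [FixStar, mem_filter, mem_univ, true_and, and_iff_right_iff_imp]
  intro hi
  have h0 : star σ 0 = Fin.last (n + 1) := rfl
  have h1 : i ≠ 0 := by
    rintro rfl
    rw [h0] at hi
    exact absurd hi (by simp)
  have h2 : i ≠ Fin.last (n + 1) := by
    rintro rfl
    exact h1 ((star σ).injective (hi.trans h0.symm))
  have := Fin.pos_iff_ne_zero.2 h1
  have := Fin.lt_last_iff_ne_last.2 h2
  simp only [Fin.lt_def, Fin.val_last, Fin.val_zero] at *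
  omega

theorem cycStar_sub_fixStar (σ : Perm (Fin (n + 1))) :
    cycStar σ - fixStar σ = Multiset.card (star σ).cycleType := by
  have h : fixStar σ = Fintype.card (Fin (n + 1 + 1)) - #(star σ).support := by
    rw [← card_compl, fixStar, FixStar_eq_filter]
    congr 1
    ext i
    simp
  rw [cycStar, cyc, Perm.parts_partition, Multiset.card_add, Multiset.card_replicate, h,
    Nat.add_sub_cancel]

theorem cycStar_sub_fixStar_mul_finRotate (ρ : Perm (Fin (n + 1))) :
    cycStar (ρ * finRotate (n + 1)) - fixStar (ρ * finRotate (n + 1)) = cycleCount ρ := by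
  rw [cycStar_sub_fixStar, star_mul_finRotate, card_cycleType_insertLast_castSucc, cycleCount]
  simp

theorem exc_mul_finRotate (ρ : Perm (Fin (n + 1))) :
    exc (ρ * finRotate (n + 1)) = #{i : Fin n | i.succ ≤ ρ i.succ} := by
  rw [exc, ← card_map (Fin.castSuccEmb (n := n))]
  congr 1
  ext i
  refine Fin.lastCases ?_ (fun k => ?_) i
  · simp [Fin.le_last, Fin.ne_of_lt, Fin.castSucc_lt_last]
  · have hk : finRotate (n + 1) k.castSucc = k.succ := by simp
    simp [Fin.castSucc_lt_iff_succ_le]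

theorem cpkStar_mul_finRotate (ρ : Perm (Fin (n + 1))) :
    cpkStar (ρ * finRotate (n + 1)) =
      #{i : Fin n | (ρ.symm i.succ ≠ 0 ∧ ρ.symm i.succ < i.succ) ∧ ρ i.succ < i.succ} := by
  rw [cpkStar, CpkStar, ← card_map ((Fin.succEmb n).trans Fin.castSuccEmb)]
  congr 1
  ext i
  rw [star_mul_finRotate]
  refine Fin.lastCases ?_ (fun k => Fin.cases ?_ (fun j => ?_) k) i
  · simp
  · simp
  · have h1 : (insertLast (ρ 0).castSucc ρ)⁻¹ j.succ.castSucc < j.succ.castSucc ↔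
        ρ.symm j.succ ≠ 0 ∧ ρ.symm j.succ < j.succ := by
      change (insertLast (ρ 0).castSucc ρ).symm j.succ.castSucc < _ ↔ _
      have h0 : j.succ.castSucc = (ρ 0).castSucc ↔ ρ.symm j.succ = 0 := by
        rw [Fin.castSucc_inj, symm_apply_eq]
      rw [insertLast_symm_apply_castSucc]
      split_ifs with h
      · simp [h0.1 h, (Fin.le_last _).not_gt]
      · simp only [mt h0.2 h, Fin.castSucc_lt_castSucc_iff, ne_eq, not_false_eq_true, true_and]
    have h2 : insertLast (ρ 0).castSucc ρ j.succ.castSucc < j.succ.castSucc ↔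
        ρ j.succ < j.succ := by
      rw [insertLast_apply_castSucc, if_neg (by simp), Fin.castSucc_lt_castSucc_iff]
    simp only [mem_filter, mem_univ, true_and, h1, h2, mem_map]
    constructor
    · rintro ⟨-, h⟩
      exact ⟨j, h, rfl⟩
    · rintro ⟨k, h, hk⟩
      have hk' : k = j := by simpa using hk
      subst hk'
      refine ⟨?_, h⟩
      have := k.isLt
      simp only [Fin.val_castSucc, Fin.val_succ]
      omega

/-- Excedances of `σ` are the nonzero weak excedances of `ρ`, that is valleys, ascents and fixed
points. The largest letter after `0` explains the convention that `0` is large as a predecessor and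
small as a successor. -/
theorem permWeight_peakExcWeights {K : Type*} [CommRing K] (x t : K) (ρ : Perm (Fin (n + 1))) :
    permWeight (peakExcWeights x t) ρ =
      x ^ cpkStar (ρ * finRotate (n + 1)) * t ^ exc (ρ * finRotate (n + 1)) := by
  rw [cpkStar_mul_finRotate, exc_mul_finRotate, ← prod_const, ← prod_const, prod_filter,
    prod_filter, ← prod_mul_distrib, permWeight]
  refine prod_congr rfl fun i _ => ?_
  rw [letterWeight]
  by_cases hf : ρ i.succ = i.succ
  · simp [hf, peakExcWeights]
  · have hf' : ρ.symm i.succ ≠ i.succ := fun h => hf ((symm_apply_eq _).1 h).symm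
    have h1 : (ρ.symm i.succ = 0 ∨ i.succ < ρ.symm i.succ) ↔
        ¬ (ρ.symm i.succ ≠ 0 ∧ ρ.symm i.succ < i.succ) := by
      rw [not_and_or, not_not, not_lt, le_iff_lt_or_eq, or_iff_left (Ne.symm hf')]
    have h2 : i.succ < ρ i.succ ↔ i.succ ≤ ρ i.succ :=
      ⟨le_of_lt, fun h => lt_of_le_of_ne h (Ne.symm hf)⟩
    simp only [if_neg hf, h1, h2]
    by_cases h3 : i.succ ≤ ρ i.succ
    · simp [h3, h3.not_gt, peakExcWeights]
    · have h4 := not_le.1 h3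
      by_cases h5 : ρ.symm i.succ ≠ 0 ∧ ρ.symm i.succ < i.succ
      · rw [if_neg (not_not.2 h5), if_neg h3, if_pos ⟨h5, h4⟩, if_neg h3]
        simp [peakExcWeights]
      · rw [if_pos h5, if_neg h3, if_neg (fun h => h5 h.1), if_neg h3]
        simp [peakExcWeights]

theorem cycPeakPoly_succ {K : Type*} [CommRing K] (q x t : K) :
    cycPeakPoly (n + 1) q x t = weightSum (peakExcWeights x t) q n := by
  rw [cycPeakPoly, weightSum, ← Equiv.sum_comp (Equiv.mulRight (finRotate (n + 1)))]
  refine sum_congr rfl fun ρ _ => ?_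
  rw [Equiv.coe_mulRight, cycStar_sub_fixStar_mul_finRotate, permWeight_peakExcWeights, smul_eq_mul,
    mul_assoc]

theorem cycEulerian_eq_cycPeakPoly {K : Type*} [CommSemiring K] (n : ℕ) (q t : K) :
    cycEulerian n q t = cycPeakPoly n q 1 t := by
  simp [cycEulerian, cycPeakPoly]

theorem cycPeakPoly_scale {K : Type*} [CommRing K] (hn : 1 ≤ n) (q : K) {x t x' t' r : K}
    (h1 : x * t = r ^ 2 * (x' * t')) (h2 : 1 + t = r * (1 + t')) :
    cycPeakPoly n q x t = r ^ (n - 1) * cycPeakPoly n q x' t' := by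
  obtain ⟨n, rfl⟩ := Nat.exists_eq_add_of_le' hn
  rw [cycPeakPoly_succ, cycPeakPoly_succ, weightSum_peakExcWeights_scale q n h1 h2,
    Nat.add_sub_cancel]

end StarCompanion

end StarStat

/-! ### The two substitutions. -/

theorem mainTheorem5 {K : Type*} [Field K] (n : ℕ) (hn : 1 ≤ n) :
    (∀ q x t : K, 1 + x ≠ 0 → x + t ≠ 0 → 1 + x * t ≠ 0 →
      StarStat.cycEulerian n q t =
        ((1 + x * t) / (1 + x)) ^ (n - 1) *
          StarStat.cycPeakPoly n q
            ((1 + x) ^ 2 * t / ((x + t) * (1 + x * t))) ((x + t) / (1 + x * t))) ∧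
    (∀ q x t s u v : K, (2 : K) ≠ 0 → x ≠ 0 → x ≠ 1 → t ≠ 0 →
      s ^ 2 = (1 + t) ^ 2 - 4 * x * t →
      u = (1 + t ^ 2 - 2 * x * t - (1 - t) * s) / (2 * (1 - x) * t) →
      v = ((1 + t) ^ 2 - 2 * x * t - (1 + t) * s) / (2 * x * t) →
      1 + u * v ≠ 0 →
      StarStat.cycPeakPoly n q x t =
        ((1 + u) / (1 + u * v)) ^ (n - 1) * StarStat.cycEulerian n q v) := by
  refine ⟨fun q x t h1 h2 h3 => ?_, fun q x t s u v h2 hx hx1 ht hs hu hv huv => ?_⟩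
  · rw [StarStat.cycEulerian_eq_cycPeakPoly]
    have h3' : 1 + t * x ≠ 0 := by rwa [mul_comm]
    apply StarStat.cycPeakPoly_scale hn
    · field_simp
    · field_simp
      ring
  · rw [StarStat.cycEulerian_eq_cycPeakPoly]
    have h1x : 1 - x ≠ 0 := sub_ne_zero.2 (Ne.symm hx1)
    have hu' : 2 * (1 - x) * t * u = 1 + t ^ 2 - 2 * x * t - (1 - t) * s := by
      rw [hu]; field_simp
    have hv' : 2 * x * t * v = (1 + t) ^ 2 - 2 * x * t - (1 + t) * s := by
      rw [hv]; field_simp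
    have ha : 2 * (1 - x) * t ≠ 0 := mul_ne_zero (mul_ne_zero h2 h1x) ht
    have hb : 2 * x * t ≠ 0 := mul_ne_zero (mul_ne_zero h2 hx) ht
    -- With denominators cleared, `s ^ 2 = (1 + t) ^ 2 - 4 * x * t` makes `1 + u`, `1 + v`, `v` and
    -- `1 + u * v` factor in `s` and `t`; the scaling conditions `e1` and `e2` for `r = (1 + u) / (1
    -- + u * v)` then compare these products.
    have hu1 : 2 * (1 - x) * t * (1 + u) = s * (s - 1 + t) := by
      linear_combination hu' - hs
    have hv1 : 2 * x * t * (1 + v) = (1 + t) * (1 + t - s) := by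
      linear_combination hv'
    have hv2 : 2 * (2 * x * t * v) = (1 + t - s) ^ 2 := by
      linear_combination 2 * hv' - hs
    have huv1 : 2 * (1 - x) * t * (2 * x * t) * (1 + u * v) = s * (s - 1 + t) * (1 + t - s) := by
      linear_combination 2 * x * t * v * hu' +
        (1 + t ^ 2 - 2 * x * t - (1 - t) * s) * hv' + (s - (1 + t ^ 2)) * hs
    have e1 : (1 + t) * (1 + u * v) = (1 + u) * (1 + v) := by
      refine mul_left_cancel₀ (mul_ne_zero ha hb) ?_
      linear_combination (1 + t) * huv1 - 2 * x * t * (1 + v) * hu1 - s * (s - 1 + t) * hv1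
    have e2 : x * t * (1 + u * v) ^ 2 = (1 + u) ^ 2 * v := by
      refine mul_left_cancel₀ (pow_ne_zero 2 (mul_ne_zero ha hb)) ?_
      have h5 : (2 * (1 - x) * t * (2 * x * t) * (1 + u * v)) ^ 2 =
          (2 * (1 - x) * t * (1 + u)) ^ 2 * (2 * (2 * x * t * v)) := by
        rw [huv1, hu1, hv2]
        ring
      linear_combination x * t * h5
    apply StarStat.cycPeakPoly_scale hn
    · field_simp
      linear_combination e2
    · field_simp
      linear_combination e1
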